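/- Let $F$ be a non-archimedean local field with residue field of characteristic $p$, let $\bar F$ be a separable closure of $F$, $G_F=\mathrm{Gal}(\bar F/F)$, $I_F\subset G_F$ the inertia group and $W_F\subset G_F$ the Weil group (the elements inducing an integral power of the $q$-power Frobenius on the residue field of $\bar F$, where $q$ is the cardinality of the residue field of $F$), with the topology for which $I_F$, with its Krull topology, is an open subgroup. For real $s\ge 0$ let $G_F^s\subset I_F$ be the ramification group in the upper numbering, i.e. the set of $\sigma\in G_F$ with $\sigma|_K\in\mathrm{Gal}(K/F)^s$ for every finite Galois extension $K/F$ inside $\bar F$. Let $\ell\ne p$ be a prime number and $E$ a finite extension of $\mathbb{Q}_\ell$. For a continuous finite-dimensional representation $\rho$ of $W_F$ on an $E$-vector space $V$, let $V_{ss}$ be its semisimplification (the direct sum of its Jordan–Hölder factors), and let the (exponent of the) Artin conductor of $\rho$ be $$a(\rho)=\epsilon(\rho)+\delta(\rho_{ss}),\qquad \epsilon(\rho)=\operatorname{codim}V^{I_F},\qquad \delta(\rho_{ss})=\int_0^\infty\operatorname{codim}V_{ss}^{G_F^s}\,ds .$$ **Proposition.** Let $\rho_\ell:W_F\to\mathrm{GL}_n(E)$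 and $\chi:W_F\to E^\times$ be continuous homomorphisms. Suppose that $\chi$ is more deeply ramified than $\rho_\ell$, meaning that there is a real number $s\ge 0$ such that $\rho_\ell$ is trivial on $G_F^s$ and $\chi$ is not. Then $a(\chi)$ is finite and $$a(\rho_\ell\otimes\chi)=\deg(\rho_\ell)\,a(\chi)=n\,a(\chi).$$ -/

import Mathlib

open scoped ValuativeRel ENNReal TensorProduct MonoidAlgebra

noncomputable section

namespace ArtinConductor

/-! ## Rings of integers, inertia group and Weil group -/

section Integers

variable (F : Type*) [Field F] [ValuativeRel F] [TopologicalSpace F]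
  [IsNonarchimedeanLocalField F]
variable (L : Type*) [Field L] [Algebra F L]

/-- The ring of integers `𝒪_L` of an algebraic extension `L` of `F`: the elements of `L` that are
integral over the valuation ring `𝒪[F]`. -/
abbrev integers : Subalgebra 𝒪[F] L := integralClosure 𝒪[F] L

/-- Since `F` is complete, `𝒪_L` is local. Its maximal ideal is denoted `𝔪_L` below. -/
instance isLocalRing_integers [Algebra.IsAlgebraic F L] : IsLocalRing (integers F L) := by
  let := IsTopologicalAddGroup.rightUniformSpace F
  have := isUniformAddGroup_of_addCommGroup (G := F)
  let : (Valued.v (R := F)).RankOne :=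
  { hom' := ValuativeRel.IsRankLeOne.nonempty.some.emb (R := F).comp
      MonoidWithZeroHom.ValueGroup₀.embedding
    strictMono' := ValuativeRel.IsRankLeOne.nonempty.some.strictMono.comp
        MonoidWithZeroHom.ValueGroup₀.embedding_strictMono }
  let : NontriviallyNormedField F := Valued.toNontriviallyNormedField F _
  have : IsUltrametricDist F := inferInstance
  have : CompleteSpace F := inferInstance
  let f := spectralMulAlgNorm F L
  have hO (a : F) : ‖a‖ ≤ 1 ↔ a ∈ 𝒪[F] := Valued.toNormedField.norm_le_one_iff
  have key (y : L) : IsIntegral 𝒪[F] y ↔ f y ≤ 1 := by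
    have hy : IsIntegral F y := Algebra.IsIntegral.isIntegral y
    change _ ↔ spectralValue (minpoly F y) ≤ 1
    rw [spectralValue_le_one_iff (minpoly.monic hy)]
    constructor
    · intro h n
      rw [minpoly.isIntegrallyClosed_eq_field_fractions' F h, Polynomial.coeff_map, hO]
      exact ((minpoly 𝒪[F] y).coeff n).2
    · intro h
      have hs : (↑(minpoly F y).coeffs : Set F) ⊆ 𝒪[F] := by
        intro a ha
        obtain ⟨n, -, rfl⟩ := Polynomial.mem_coeffs_iff.mp ha
        exact (hO _).mp (h n)
      refine ⟨(minpoly F y).toSubring 𝒪[F] hs,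
        (Polynomial.monic_toSubring _ _ _).mpr (minpoly.monic hy), ?_⟩
      have := minpoly.aeval F y
      rw [← Polynomial.map_toSubring (minpoly F y) 𝒪[F] hs] at this
      rwa [Polynomial.aeval_def, Polynomial.eval₂_map] at this
  have hunit (y : integers F L) : IsUnit y ↔ f y = 1 := by
    constructor
    · rintro ⟨u, rfl⟩
      have h1 : f (u : integers F L) ≤ 1 := (key _).mp (u : integers F L).2
      have h2 : f ((u⁻¹ : (integers F L)ˣ) : integers F L) ≤ 1 :=
        (key _).mp ((u⁻¹ : (integers F L)ˣ) : integers F L).2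
      have h3 : f (u : integers F L) * f ((u⁻¹ : (integers F L)ˣ) : integers F L) = 1 := by
        rw [← map_mul, ← MulMemClass.coe_mul, Units.mul_inv, OneMemClass.coe_one, map_one]
      have := apply_nonneg f ((u : integers F L) : L)
      nlinarith
    · intro h
      have h0 : (y : L) ≠ 0 := by
        intro h0
        rw [h0, map_zero] at h
        exact zero_ne_one h
      have h1 : f (y : L)⁻¹ = 1 := by
        have : f (y : L) * f (y : L)⁻¹ = 1 := by
          rw [← map_mul, mul_inv_cancel₀ h0, map_one]
        rwa [h, one_mul] at this
      exact IsUnit.of_mul_eq_one (⟨(y : L)⁻¹, (key _).mpr h1.le⟩ : integers F L)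
        (Subtype.ext (mul_inv_cancel₀ h0))
  refine IsLocalRing.of_nonunits_add fun a b ha hb => ?_
  rw [mem_nonunits_iff, hunit] at *
  have ha' : f (a : L) < 1 := lt_of_le_of_ne ((key _).mp a.2) ha
  have hb' : f (b : L) < 1 := lt_of_le_of_ne ((key _).mp b.2) hb
  have hab : f ((a : L) + b) ≤ max (f (a : L)) (f (b : L)) :=
    isNonarchimedean_spectralNorm (K := F) (L := L) (a : L) (b : L)
  exact (hab.trans_lt (max_lt ha' hb')).ne

variable [Algebra.IsAlgebraic F L]

/-- The inertia subgroup: the automorphisms acting trivially on the residue field of `L`. -/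
def inertiaSubgroup : Subgroup Gal(L/F) where
  carrier := {σ | ∀ z : IsLocalRing.ResidueField (integers F L), σ • z = z}
  one_mem' := fun z => one_smul _ z
  mul_mem' := fun {σ τ} hσ hτ z => by rw [mul_smul, hτ z, hσ z]
  inv_mem' := fun {σ} hσ z => by rw [inv_smul_eq_iff, hσ z]

/-- The automorphisms of `L` over `F` that induce on the residue field of `L` an integral power
of the Frobenius `z ↦ z ^ q`, where `q` is the cardinality of the residue field of `F`. -/
def weilSubgroup : Subgroup Gal(L/F) where
  carrier := {σ | ∃ n : ℕ,
    (∀ z : IsLocalRing.ResidueField (integers F L), σ • z = z ^ (Nat.card 𝓀[F] ^ n)) ∨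
    (∀ z : IsLocalRing.ResidueField (integers F L), σ⁻¹ • z = z ^ (Nat.card 𝓀[F] ^ n))}
  one_mem' := ⟨0, Or.inl fun z => by simp⟩
  mul_mem' := by
    have sub {a b : ℕ} (h : a ≤ b) (z w : IsLocalRing.ResidueField (integers F L))
        (hz : z ^ (Nat.card 𝓀[F] ^ a) = w) :
        z ^ (Nat.card 𝓀[F] ^ b) = w ^ (Nat.card 𝓀[F] ^ (b - a)) := by
      rw [← hz, ← pow_mul, ← pow_add, Nat.add_sub_cancel' h]
    rintro σ τ ⟨n, hσ | hσ⟩ ⟨m, hτ | hτ⟩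
    · exact ⟨m + n, Or.inl fun z => by rw [mul_smul, hσ, hτ, ← pow_mul, ← pow_add]⟩
    · have hτ' (z : IsLocalRing.ResidueField (integers F L)) :
          (τ • z) ^ (Nat.card 𝓀[F] ^ m) = z := by rw [← hτ, inv_smul_smul]
      rcases le_total m n with h | h
      · exact ⟨n - m, Or.inl fun z => by rw [mul_smul, hσ, sub h _ _ (hτ' z)]⟩
      · refine ⟨m - n, Or.inr fun z => ?_⟩
        rw [mul_inv_rev, mul_smul, hτ, sub h _ z (by rw [← hσ, smul_inv_smul])]
    · have hσ' (z : IsLocalRing.ResidueField (integers F L)) :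
          (σ • z) ^ (Nat.card 𝓀[F] ^ n) = z := by rw [← hσ, inv_smul_smul]
      rcases le_total n m with h | h
      · exact ⟨m - n, Or.inl fun z => by rw [mul_smul, hτ, smul_pow', sub h _ _ (hσ' z)]⟩
      · refine ⟨n - m, Or.inr fun z => ?_⟩
        rw [mul_inv_rev, mul_smul, hσ, smul_pow', sub h _ z (by rw [← hτ, smul_inv_smul])]
    · exact ⟨n + m, Or.inr fun z => by
        rw [mul_inv_rev, mul_smul, hτ, hσ, ← pow_mul, ← pow_add]⟩
  inv_mem' := by
    rintro σ ⟨n, h | h⟩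
    · exact ⟨n, Or.inr fun z => by rw [inv_inv, h]⟩
    · exact ⟨n, Or.inl h⟩

end Integers

/-! ## Ramification groups -/

section Ramification

variable (F : Type*) [Field F] [ValuativeRel F] [TopologicalSpace F]
  [IsNonarchimedeanLocalField F]

section FiniteLevel

variable (K : Type*) [Field K] [Algebra F K] [Algebra.IsAlgebraic F K]

/-- The ramification groups in the lower numbering, `G_r = G_⌈r⌉` for real `r ≥ -1`: those `σ` with
`v_K (σ x - x) ≥ ⌈r⌉ + 1`, that is `σ x - x ∈ 𝔪_K ^ (⌈r⌉ + 1)`, for all `x ∈ 𝒪_K`. -/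
def lowerRamificationGroup (r : ℝ) : Subgroup Gal(K/F) :=
  (IsLocalRing.maximalIdeal (integers F K) ^ ⌈r + 1⌉₊).inertia Gal(K/F)

/-- The Herbrand function `φ` on `[-1, ∞)`: it has `φ (-1) = -1` and slope `1 / [G_0 : G_r]`. -/
def herbrandPhi (r : ℝ) : ℝ :=
  -1 + ∫ t in (-1)..r,
    (((lowerRamificationGroup F K t).relIndex (lowerRamificationGroup F K 0) : ℕ) : ℝ)⁻¹

/-- `ψ`, the inverse of the bijection `φ : [-1, ∞) → [-1, ∞)`. -/
def herbrandPsi (s : ℝ) : ℝ :=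
  Function.invFunOn (herbrandPhi F K) (Set.Ici (-1)) s

/-- The ramification groups in the upper numbering, `G^s = G_{ψ (s)}`, for `s ≥ -1`. -/
def upperRamificationGroup (s : ℝ) : Subgroup Gal(K/F) :=
  lowerRamificationGroup F K (herbrandPsi F K s)

end FiniteLevel

variable (Fbar : Type*) [Field Fbar] [Algebra F Fbar]

/-- The group `G_F^s`: the `σ` whose restriction to `K` is in `Gal(K/F)^s` for every finite Galois
extension `K` of `F` inside `Fbar`. -/
def absoluteRamificationGroup (s : ℝ) : Subgroup Gal(Fbar/F) :=
  ⨅ K : FiniteGaloisIntermediateField F Fbar,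
    (upperRamificationGroup F K s).comap (AlgEquiv.restrictNormalHom K)

end Ramification

/-! ## The Weil group -/

section Weil

variable (F : Type*) [Field F] [ValuativeRel F] [TopologicalSpace F]
  [IsNonarchimedeanLocalField F]
variable (Fbar : Type*) [Field Fbar] [Algebra F Fbar] [Algebra.IsAlgebraic F Fbar]

/-- The Weil group `W_F`, as a type of its own because its topology is not the subspace
topology. -/
def WeilGroup : Type _ := weilSubgroup F Fbar

namespace WeilGroup

instance : Group (WeilGroup F Fbar) := inferInstanceAs (Group (weilSubgroup F Fbar))

/-- The inclusion of `W_F` in `G_F`. -/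
def toGal : WeilGroup F Fbar →* Gal(Fbar/F) := (weilSubgroup F Fbar).subtype

/-- The inertia group `I_F` as a subgroup of `W_F`. -/
def inertia : Subgroup (WeilGroup F Fbar) := (inertiaSubgroup F Fbar).comap (toGal F Fbar)

/-- The ramification group `G_F^s` as a subgroup of `W_F`, for `s ≥ 0`. -/
def ramification (s : ℝ) : Subgroup (WeilGroup F Fbar) :=
  (absoluteRamificationGroup F Fbar s).comap (toGal F Fbar)

/-- The topology of `W_F` is the coarsest one that refines the Krull topology and for which the
cosets of `I_F` are open. -/
instance instTopologicalSpace : TopologicalSpace (WeilGroup F Fbar) :=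
  TopologicalSpace.induced (toGal F Fbar) inferInstance ⊓
    TopologicalSpace.induced (QuotientGroup.mk : _ → WeilGroup F Fbar ⧸ inertia F Fbar) ⊥

theorem quotient_mk_eq_one_iff (w : WeilGroup F Fbar) :
    (QuotientGroup.mk w : WeilGroup F Fbar ⧸ inertia F Fbar) = QuotientGroup.mk 1 ↔
      w ∈ inertia F Fbar := by
  rw [eq_comm, QuotientGroup.eq, inv_one, one_mul]

/-- `I_F` is an open subgroup of `W_F`. -/
theorem isOpen_inertia : IsOpen (inertia F Fbar : Set (WeilGroup F Fbar)) := by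
  have hle : instTopologicalSpace F Fbar ≤ TopologicalSpace.induced
      (QuotientGroup.mk : _ → WeilGroup F Fbar ⧸ inertia F Fbar) ⊥ := inf_le_right
  refine hle _ ⟨{(QuotientGroup.mk 1 : WeilGroup F Fbar ⧸ inertia F Fbar)}, trivial, ?_⟩
  ext w
  exact quotient_mk_eq_one_iff F Fbar w

/-- The topology that `I_F` inherits from `W_F` is the one it inherits from `G_F`. -/
theorem inertia_topology :
    (instTopologicalSpaceSubtype : TopologicalSpace (inertia F Fbar)) =
      TopologicalSpace.induced (fun w : inertia F Fbar => toGal F Fbar w) inferInstance := by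
  change TopologicalSpace.induced _ (_ ⊓ _) = _
  rw [induced_inf, induced_compose, induced_compose]
  refine inf_eq_left.mpr fun U hU => ?_
  obtain ⟨S, -, rfl⟩ := hU
  have hw (w : inertia F Fbar) :=
    (quotient_mk_eq_one_iff F Fbar (w : WeilGroup F Fbar)).mpr w.2
  by_cases h : (QuotientGroup.mk 1 : WeilGroup F Fbar ⧸ inertia F Fbar) ∈ S
  · rw [Set.eq_univ_of_forall (s := _ ⁻¹' S) fun w => by simpa [hw w] using h]
    exact @isOpen_univ _ (_)
  · rw [Set.eq_empty_of_forall_notMem (s := _ ⁻¹' S) fun w => by simpa [hw w] using h]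
    exact @isOpen_empty _ (_)

end WeilGroup

end Weil

/-! ## Conductors -/

section SemiSimplification

variable {E W V : Type*} [Field E] [Group W] [AddCommGroup V] [Module E V] [FiniteDimensional E V]
variable (ρ : Representation E W V)

theorem exists_compositionSeries :
    ∃ s : CompositionSeries (Submodule E[W] ρ.asModule), s.head = ⊥ ∧ s.last = ⊤ := by
  have : FiniteDimensional E ρ.asModule := inferInstanceAs (FiniteDimensional E V)
  have : IsNoetherian E[W] ρ.asModule := isNoetherian_of_tower E inferInstance
  have : IsArtinian E[W] ρ.asModule := isArtinian_of_tower E inferInstance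
  exact exists_compositionSeries_of_isNoetherian_isArtinian _ _

/-- A composition series `0 = V_0 < V_1 < ⋯ < V_r = V` of `V` as a module over `E[W]`. -/
def compositionSeries : CompositionSeries (Submodule E[W] ρ.asModule) :=
  (exists_compositionSeries ρ).choose

/-- The Jordan–Hölder factor `V_{i+1} / V_i`. -/
abbrev JordanHolderFactor (i : Fin (compositionSeries ρ).length) : Type _ :=
  ↥(compositionSeries ρ i.succ) ⧸
    (compositionSeries ρ i.castSucc).submoduleOf (compositionSeries ρ i.succ)

/-- The space `V_ss`: the direct sum of the Jordan–Hölder factors of `V`. -/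
def SemisimplificationSpace : Type _ :=
  ∀ i : Fin (compositionSeries ρ).length, JordanHolderFactor ρ i

instance : AddCommGroup (SemisimplificationSpace ρ) :=
  inferInstanceAs (AddCommGroup (∀ i, JordanHolderFactor ρ i))

instance : Module E (SemisimplificationSpace ρ) :=
  inferInstanceAs (Module E (∀ i, JordanHolderFactor ρ i))

instance : Module E[W] (SemisimplificationSpace ρ) :=
  inferInstanceAs (Module E[W] (∀ i, JordanHolderFactor ρ i))

instance : IsScalarTower E E[W] (SemisimplificationSpace ρ) :=
  inferInstanceAs (IsScalarTower E E[W] (∀ i, JordanHolderFactor ρ i))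

/-- The semisimplification `ρ_ss`: the representation on `V_ss`. -/
def semisimplification : Representation E W (SemisimplificationSpace ρ) :=
  Representation.ofModule' _

end SemiSimplification

section Conductor

variable {E : Type*} [Field E]

/-- `codim V^H = dim (V / V^H)`, where `V^H` is the subspace of invariants of the subgroup `H`. -/
def codimInvariants {W V : Type*} [Group W] [AddCommGroup V] [Module E V]
    (ρ : Representation E W V) (H : Subgroup W) : ℕ :=
  Module.finrank E (V ⧸ Representation.invariants (ρ.comp H.subtype))

variable {F : Type*} [Field F] [ValuativeRel F] [TopologicalSpace F]
  [IsNonarchimedeanLocalField F]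
variable {Fbar : Type*} [Field Fbar] [Algebra F Fbar] [Algebra.IsAlgebraic F Fbar]
variable {V : Type*} [AddCommGroup V] [Module E V]

/-- The tame conductor `ε(ρ) = codim V^{I_F}`. -/
def tameConductor (ρ : Representation E (WeilGroup F Fbar) V) : ℕ :=
  codimInvariants ρ (WeilGroup.inertia F Fbar)

/-- The wild (Swan) conductor `δ(ρ) = ∫_0^∞ codim V^{G_F^s} ds`, as an element of `[0, ∞]`. -/
def wildConductor (ρ : Representation E (WeilGroup F Fbar) V) : ℝ≥0∞ :=
  ∫⁻ s in Set.Ioi (0 : ℝ), (codimInvariants ρ (WeilGroup.ramification F Fbar s) : ℝ≥0∞)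

/-- The conductor `a(ρ) = ε(ρ) + δ(ρ_ss)`, where `ρ_ss` is the semisimplification of `ρ`. -/
def conductor [FiniteDimensional E V] (ρ : Representation E (WeilGroup F Fbar) V) : ℝ≥0∞ :=
  tameConductor ρ + wildConductor (semisimplification ρ)

/-- The representation on `E^n` given by a homomorphism to `GL_n(E)`. -/
def ofGL {W : Type*} [Group W] {n : ℕ} (ρ : W →* GL (Fin n) E) :
    Representation E W (Fin n → E) :=
  ((Matrix.toLinAlgEquiv' : Matrix (Fin n) (Fin n) E ≃ₐ[E] _) : _ →* _).comp
    ((Units.coeHom _).comp ρ)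

/-- The representation on the line `E` given by a character. -/
def ofCharacter {W : Type*} [Group W] (χ : W →* Eˣ) : Representation E W E :=
  (Algebra.lmul E E : _ →* _).comp ((Units.coeHom _).comp χ)

/-- `χ` is more deeply ramified than `ρ`: for some real `s ≥ 0`, `ρ` is trivial on `G_F^s` and `χ`
is not. -/
def IsMoreDeeplyRamified {n : ℕ} (χ : WeilGroup F Fbar →* Eˣ)
    (ρ : WeilGroup F Fbar →* GL (Fin n) E) : Prop :=
  ∃ s : ℝ, 0 ≤ s ∧ (∀ w ∈ WeilGroup.ramification F Fbar s, ρ w = 1) ∧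
    ∃ w ∈ WeilGroup.ramification F Fbar s, χ w ≠ 1

end Conductor

end ArtinConductor

end

/-!
Let `χ` be nontrivial on `G_F^s` and `ρ` trivial on it. On `G_F^s` the representation `ρ ⊗ χ` acts
through the scalars `χ`, and so does its semisimplification, as an element acting as a scalar on a
module acts as the same scalar on every subquotient (`semisimplification_eq_smul`). A subgroup `H`
containing `G_F^s` therefore has no nonzero invariants in `ρ ⊗ χ`, in its semisimplification or in
`χ`; on a subgroup contained in `G_F^s` all of them are given by the same scalars. In both cases the
codimension of the `H`-invariants for `ρ ⊗ χ` is `n` times the one for `χ`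
(`codimInvariants_eq_mul`). The inertia group contains `G_F^s` (`ramification_le_inertia`) and every
`G_F^t` is comparable with it (`ramification_le`), so that the tame conductors and the integrands of
the wild conductors are proportional with factor `n` (`conductor_eq_finrank_mul`).

The conductor of `χ` is finite because `χ` is trivial on `G_F^s` for large `s`
(`exists_forall_ramification_eq_one`). By continuity there is a finite Galois extension `K` of `F`
such that `‖χ w - 1‖ < 1` for the `w` in the inertia group that are trivial on `K`. This holds for
`w` in `G_F^s` when `s` is large, since the ramification groups of `K` are eventually trivial. For
`s > 0` the image of such a `w` in every finite Galois group has order a power of `p`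
(`exists_pow_prime_pow_eq_one`), whence some `χ w ^ p ^ k` are arbitrarily close to `1`. As `p` is a
unit in `ℤ_ℓ`, raising to the power `p ^ k` preserves the distance to `1` in the open unit ball
around `1` (`norm_pow_sub_one_eq`), and `χ w = 1` follows.

That the elements of `G_1` have `p`-power order comes from the local ring `𝒪_K` alone: an
automorphism that is trivial modulo `𝔪 ^ 2` and whose order is invertible in `𝒪_K` is trivial modulo
every power of `𝔪` (`smul_eq_self_of_pow_eq_one`). The passage between the two numberings needs only
that the Herbrand function `φ` is continuous, strictly increasing and unbounded, with `φ 0 = 0`.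
-/

/-! ### Semisimplification and scalar operators -/

namespace ArtinConductor

section Representations

variable {E W V : Type*} [Field E] [Group W] [AddCommGroup V] [Module E V]

/-- Dimensions of the factors of a composition series telescope. -/
theorem sum_finrank_factors {A M : Type*} [Ring A] [Algebra E A] [AddCommGroup M] [Module E M]
    [Module A M] [IsScalarTower E A M] [FiniteDimensional E M]
    (s : CompositionSeries (Submodule A M)) (h0 : s.head = ⊥) (h1 : s.last = ⊤) :
    ∑ i : Fin s.length, Module.finrank E (↥(s i.succ) ⧸ (s i.castSucc).submoduleOf (s i.succ)) =
      Module.finrank E M := by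
  have fd (N : Submodule A M) : FiniteDimensional E N :=
    inferInstanceAs (FiniteDimensional E (N.restrictScalars E))
  have step (i : Fin s.length) :
      Module.finrank E (↥(s i.succ) ⧸ (s i.castSucc).submoduleOf (s i.succ)) +
        Module.finrank E (s i.castSucc) = Module.finrank E (s i.succ) := by
    have hle : s i.castSucc ≤ s i.succ := (s.step i).le
    have := fd (s i.succ)
    rw [← (Submodule.Quotient.restrictScalarsEquiv E
        ((s i.castSucc).submoduleOf (s i.succ))).finrank_eq,
      ← ((Submodule.submoduleOfEquivOfLe hle).restrictScalars E).finrank_eq]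
    exact Submodule.finrank_quotient_add_finrank
      (((s i.castSucc).submoduleOf (s i.succ)).restrictScalars E)
  have hsum := Finset.sum_congr (rfl : (Finset.univ : Finset (Fin s.length)) = _)
    fun i _ => step i
  rw [Finset.sum_add_distrib] at hsum
  have hsplit := (Fin.sum_univ_castSucc fun i => Module.finrank E (s i)).symm.trans
    (Fin.sum_univ_succ fun i => Module.finrank E (s i))
  have hbot : Module.finrank E (s 0) = 0 := by
    rw [show s 0 = ⊥ from h0]
    exact finrank_bot E M
  have htop : Module.finrank E (s (Fin.last _)) = Module.finrank E M := by
    rw [show s (Fin.last _) = ⊤ from h1]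
    exact finrank_top E M
  omega

theorem finrank_semisimplificationSpace [FiniteDimensional E V] (ρ : Representation E W V) :
    Module.finrank E (SemisimplificationSpace ρ) = Module.finrank E V := by
  have : FiniteDimensional E ρ.asModule := inferInstanceAs (FiniteDimensional E V)
  have fd (N : Submodule E[W] ρ.asModule) : FiniteDimensional E N :=
    inferInstanceAs (FiniteDimensional E (N.restrictScalars E))
  have fdq (i : Fin (compositionSeries ρ).length) :
      FiniteDimensional E (JordanHolderFactor ρ i) :=
    Module.Finite.equiv (Submodule.Quotient.restrictScalarsEquiv E
      ((compositionSeries ρ i.castSucc).submoduleOf (compositionSeries ρ i.succ)))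
  have free (i : Fin (compositionSeries ρ).length) : Module.Free E (JordanHolderFactor ρ i) :=
    Module.Free.of_equiv (Submodule.Quotient.restrictScalarsEquiv E
      ((compositionSeries ρ i.castSucc).submoduleOf (compositionSeries ρ i.succ)))
  exact (Module.finrank_pi_fintype E (M := JordanHolderFactor ρ)).trans
    (sum_finrank_factors (compositionSeries ρ) (exists_compositionSeries ρ).choose_spec.1
      (exists_compositionSeries ρ).choose_spec.2)

/-- An element acting on `V` as a scalar acts on every subquotient, hence on `V_ss`, as the same
scalar. -/
theorem semisimplification_eq_smul [FiniteDimensional E V] (ρ : Representation E W V) {w : W}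
    {c : E} (h : ρ w = c • 1) : semisimplification ρ w = c • 1 := by
  have key (m : ρ.asModule) : MonoidAlgebra.single w (1 : E) • m = c • m := by
    rw [Representation.single_smul, h, one_smul]
    rfl
  refine LinearMap.ext fun v => funext fun i => ?_
  obtain ⟨x, hx⟩ := Submodule.Quotient.mk_surjective _ (v i)
  change MonoidAlgebra.single w (1 : E) • v i = c • v i
  rw [← hx, ← Submodule.Quotient.mk_smul, ← Submodule.Quotient.mk_smul]
  exact congrArg _ (Subtype.ext (key x))

theorem codimInvariants_eq_zero (ρ : Representation E W V) {H : Subgroup W}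
    (h : ∀ w ∈ H, ρ w = 1) : codimInvariants ρ H = 0 := by
  have : Representation.invariants (ρ.comp H.subtype) = ⊤ := by
    refine eq_top_iff.mpr fun v _ => ?_
    rw [Representation.mem_invariants]
    intro w
    change ρ w v = v
    rw [h w w.2]
    rfl
  rw [codimInvariants, this]
  exact Module.finrank_zero_of_subsingleton

theorem codimInvariants_eq_finrank (ρ : Representation E W V) {H : Subgroup W} {w : W} (hw : w ∈ H)
    {c : E} (hc : c ≠ 1) (h : ρ w = c • 1) : codimInvariants ρ H = Module.finrank E V := by
  have : Representation.invariants (ρ.comp H.subtype) = ⊥ := by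
    refine eq_bot_iff.mpr fun v hv => ?_
    rw [Representation.mem_invariants] at hv
    have hv' : ρ w v = v := hv ⟨w, hw⟩
    rw [h] at hv'
    have : (c - 1) • v = 0 := by
      rw [sub_smul, one_smul, sub_eq_zero]
      exact hv'
    exact (smul_eq_zero.mp this).resolve_left (sub_ne_zero.mpr hc)
  rw [codimInvariants, this]
  exact (Submodule.quotEquivOfEqBot _ rfl).finrank_eq

theorem ofCharacter_eq_smul (χ : W →* Eˣ) (w : W) : ofCharacter χ w = (χ w : E) • 1 :=
  LinearMap.ext fun _ => rfl

/-- If `ρ` acts on `S` through a character `χ` that is nontrivial on `S`, then a subgroup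
comparable with `S` has either no invariants in `ρ` and in `χ`, or acts trivially on both. -/
theorem codimInvariants_eq_mul (ρ : Representation E W V) (χ : W →* Eˣ) {S H : Subgroup W}
    (hS : ∀ w ∈ S, ρ w = (χ w : E) • 1) (hχ : ∃ w ∈ S, χ w ≠ 1) (hH : H ≤ S ∨ S ≤ H) :
    codimInvariants ρ H = Module.finrank E V * codimInvariants (ofCharacter χ) H := by
  by_cases hne : ∃ w ∈ H, w ∈ S ∧ χ w ≠ 1
  · obtain ⟨w, hw, hwS, hw1⟩ := hne
    have hc : (χ w : E) ≠ 1 := fun h => hw1 (Units.ext h)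
    rw [codimInvariants_eq_finrank ρ hw hc (hS w hwS),
      codimInvariants_eq_finrank _ hw hc (ofCharacter_eq_smul χ w), Module.finrank_self, mul_one]
  · push Not at hne
    have hle : H ≤ S := hH.resolve_right fun hSH => by
      obtain ⟨w, hw, hw1⟩ := hχ
      exact hw1 (hne w (hSH hw) hw)
    have h1 (w : W) (hw : w ∈ H) : (χ w : E) = 1 := by rw [hne w hw (hle hw), Units.val_one]
    rw [codimInvariants_eq_zero ρ fun w hw => by rw [hS w (hle hw), h1 w hw, one_smul],
      codimInvariants_eq_zero _ fun w hw => by rw [ofCharacter_eq_smul, h1 w hw, one_smul],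
      mul_zero]

/-- The variant of `codimInvariants_eq_mul` for semisimplifications. -/
theorem codimInvariants_semisimplification_eq_mul [FiniteDimensional E V]
    (ρ : Representation E W V) (χ : W →* Eˣ) {S H : Subgroup W}
    (hS : ∀ w ∈ S, ρ w = (χ w : E) • 1) (hχ : ∃ w ∈ S, χ w ≠ 1) (hH : H ≤ S ∨ S ≤ H) :
    codimInvariants (semisimplification ρ) H =
      Module.finrank E V * codimInvariants (semisimplification (ofCharacter χ)) H := by
  rw [codimInvariants_eq_mul _ χ (fun w hw => semisimplification_eq_smul ρ (hS w hw)) hχ hH,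
    codimInvariants_eq_mul _ χ
      (fun w _ => semisimplification_eq_smul _ (ofCharacter_eq_smul χ w)) hχ hH,
    finrank_semisimplificationSpace, finrank_semisimplificationSpace, Module.finrank_self, one_mul]

theorem ofGL_tprod_ofCharacter_eq_smul {n : ℕ} (ρ : W →* GL (Fin n) E) (χ : W →* Eˣ) {w : W}
    (h : ρ w = 1) : (ofGL ρ).tprod (ofCharacter χ) w = (χ w : E) • 1 := by
  have h1 : ofGL ρ w = 1 := by simp [ofGL, h]
  rw [Representation.tprod_apply, h1, ofCharacter_eq_smul, TensorProduct.map_smul_right]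
  exact congrArg _ TensorProduct.map_one

end Representations

/-! ### Wild automorphisms of local rings -/

section LocalRing

open IsLocalRing

variable {R G : Type*} [CommRing R] [IsLocalRing R] [Group G] [MulSemiringAction G R]

/-- If `σ` is congruent to the identity modulo `𝔪 ^ n`, then it is congruent to the identity modulo
`𝔪 ^ (n + 1)` on `𝔪 ^ 2`. -/
theorem smul_sub_mem_pow_succ {σ : G} {n : ℕ} (hn : n ≠ 0)
    (hσ : ∀ x : R, σ • x - x ∈ maximalIdeal R ^ n) {y : R} (hy : y ∈ maximalIdeal R ^ 2) :
    σ • y - y ∈ maximalIdeal R ^ (n + 1) := by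
  rw [pow_two] at hy
  induction hy using Submodule.mul_induction_on' with
  | mem_mul_mem a ha b hb =>
    have hσa : σ • a ∈ maximalIdeal R := by
      rw [← sub_add_cancel (σ • a) a]
      exact add_mem (Ideal.pow_le_self hn (hσ a)) ha
    have : σ • (a * b) - a * b = (σ • b - b) * σ • a + (σ • a - a) * b := by
      rw [smul_mul']
      ring
    rw [this, pow_succ]
    exact add_mem (Ideal.mul_mem_mul (hσ b) hσa) (Ideal.mul_mem_mul (hσ a) hb)
  | add x _ y _ hx hy =>
    have : σ • (x + y) - (x + y) = (σ • x - x) + (σ • y - y) := by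
      rw [smul_add]
      ring
    rw [this]
    exact add_mem hx hy

/-- Writing `σ x = x + y` with `y ∈ 𝔪 ^ n`, one has `σ ^ j x ≡ x + j y` modulo `𝔪 ^ (n + 1)`. -/
theorem pow_smul_sub_mem_pow_succ {σ : G} {n : ℕ} (hn : 2 ≤ n)
    (hσ : ∀ x : R, σ • x - x ∈ maximalIdeal R ^ n) (x : R) (j : ℕ) :
    σ ^ j • x - x - j * (σ • x - x) ∈ maximalIdeal R ^ (n + 1) := by
  induction j with
  | zero => simp
  | succ j ih =>
    have hz : σ ^ j • x - x ∈ maximalIdeal R ^ 2 := by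
      refine Ideal.pow_le_pow_right hn ?_
      rw [← sub_add_cancel (σ ^ j • x - x) (j * (σ • x - x))]
      exact add_mem (Ideal.pow_le_pow_right n.le_succ ih) (Ideal.mul_mem_left _ _ (hσ x))
    have : σ ^ (j + 1) • x - x - ((j + 1 : ℕ) : R) * (σ • x - x) =
        (σ ^ j • x - x - j * (σ • x - x)) +
          (σ • (σ ^ j • x - x) - (σ ^ j • x - x)) := by
      rw [smul_sub, smul_smul, ← pow_succ', Nat.cast_succ]
      ring
    rw [this]
    exact add_mem ih (smul_sub_mem_pow_succ (by omega) hσ hz)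

theorem smul_eq_self_of_forall_mem_pow [IsNoetherianRing R] {σ : G} {x : R}
    (h : ∀ n : ℕ, σ • x - x ∈ maximalIdeal R ^ n) : σ • x = x := by
  have hbot := Ideal.iInf_pow_eq_bot_of_isLocalRing (maximalIdeal R)
    (maximalIdeal.isMaximal R).ne_top
  have : σ • x - x ∈ ⨅ n : ℕ, maximalIdeal R ^ n := Submodule.mem_iInf _ |>.mpr h
  rw [hbot] at this
  exact sub_eq_zero.mp this

/-- An automorphism that is trivial modulo `𝔪 ^ 2` and whose order is invertible in `R` is
trivial. -/
theorem smul_eq_self_of_pow_eq_one [IsNoetherianRing R] {σ : G}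
    (hσ : ∀ x : R, σ • x - x ∈ maximalIdeal R ^ 2) {l : ℕ} (hl : IsUnit (l : R))
    (h : σ ^ l = 1) (x : R) : σ • x = x := by
  have key (n : ℕ) : ∀ x : R, σ • x - x ∈ maximalIdeal R ^ (n + 2) := by
    induction n with
    | zero => exact hσ
    | succ n ih =>
      intro x
      have := pow_smul_sub_mem_pow_succ (by omega) ih x l
      rw [h, one_smul, sub_self, zero_sub, neg_mem_iff] at this
      exact (Ideal.unit_mul_mem_iff_mem _ hl).mp this
  exact smul_eq_self_of_forall_mem_pow fun n =>
    Ideal.pow_le_pow_right (Nat.le_add_right n 2) (key n x)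

end LocalRing

end ArtinConductor

/-! ### Ramification groups of a finite separable extension -/

namespace ArtinConductor

section FiniteLevel

theorem eq_one_of_forall_smul_eq (F : Type*) [Field F] [ValuativeRel F] {K : Type*} [Field K]
    [Algebra F K] [Algebra.IsAlgebraic F K] {σ : Gal(K/F)}
    (h : ∀ x : integers F K, σ • x = x) : σ = 1 := by
  refine AlgEquiv.ext fun y => ?_
  obtain ⟨m, hm⟩ := IsIntegral.exists_multiple_integral_of_isLocalization
    (nonZeroDivisors 𝒪[F]) (Rₘ := F) y (Algebra.IsIntegral.isIntegral y)
  have hm0 : algebraMap F K (m : 𝒪[F]) ≠ 0 :=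
    (map_ne_zero _).mpr fun h0 => nonZeroDivisors.ne_zero m.2 (Subtype.ext h0)
  have hmy : (m • y : K) = algebraMap F K (m : 𝒪[F]) * y := by
    rw [← Algebra.smul_def]
    rfl
  have : σ (m • y) = m • y := congrArg Subtype.val (h ⟨m • y, hm⟩)
  rw [hmy, map_mul, AlgEquiv.commutes] at this
  exact mul_left_cancel₀ hm0 this

variable (F : Type*) [Field F] [ValuativeRel F] [TopologicalSpace F]
  [IsNonarchimedeanLocalField F]
variable (K : Type*) [Field K] [Algebra F K]

theorem isNoetherianRing_integers [FiniteDimensional F K] [Algebra.IsSeparable F K] :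
    IsNoetherianRing (integers F K) :=
  IsIntegralClosure.isNoetherianRing 𝒪[F] F K (integers F K)

theorem isUnit_natCast_integers (p : ℕ) [CharP 𝓀[F] p] [Algebra.IsAlgebraic F K] {l : ℕ}
    (hl : ¬ p ∣ l) : IsUnit (l : integers F K) := by
  have : IsUnit (l : 𝒪[F]) := by
    rw [← IsLocalRing.residue_ne_zero_iff_isUnit, map_natCast]
    exact fun h0 => hl ((CharP.cast_eq_zero_iff 𝓀[F] p l).mp h0)
  simpa using this.map (algebraMap 𝒪[F] (integers F K))

variable [FiniteDimensional F K]

theorem lowerRamificationGroup_antitone : Antitone (lowerRamificationGroup F K) :=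
  fun _ _ h _ hσ x => Ideal.pow_le_pow_right (Nat.ceil_mono (by linarith)) (hσ x)

theorem lowerRamificationGroup_relIndex_ne_zero (t : ℝ) :
    (lowerRamificationGroup F K t).relIndex (lowerRamificationGroup F K 0) ≠ 0 :=
  Subgroup.index_ne_zero_of_finite

variable {K} in
theorem smul_sub_mem_of_mem_lowerRamificationGroup {r : ℝ} {n : ℕ} (hn : (n : ℝ) < r + 2)
    {σ : Gal(K/F)} (hσ : σ ∈ lowerRamificationGroup F K r) (x : integers F K) :
    σ • x - x ∈ IsLocalRing.maximalIdeal (integers F K) ^ n := by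
  refine Ideal.pow_le_pow_right ?_ (hσ x)
  rcases n with _ | n
  · exact Nat.zero_le _
  · refine Nat.succ_le_of_lt (Nat.lt_ceil.mpr ?_)
    push_cast at hn
    linarith

/-- The groups `G_r` are trivial for large `r`, since `⋂ 𝔪 ^ n = 0`. -/
theorem exists_lowerRamificationGroup_eq_bot [Algebra.IsSeparable F K] :
    ∃ N : ℝ, ∀ r, N ≤ r → lowerRamificationGroup F K r = ⊥ := by
  have := isNoetherianRing_integers F K
  have key (σ : Gal(K/F)) : ∃ n : ℕ, σ ∈ lowerRamificationGroup F K n → σ = 1 := by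
    by_contra! h
    refine (h 0).2 (eq_one_of_forall_smul_eq F fun x => smul_eq_self_of_forall_mem_pow fun n => ?_)
    exact smul_sub_mem_of_mem_lowerRamificationGroup F (by linarith) (h n).1 x
  choose n hn using key
  obtain ⟨N, hN⟩ := (Set.finite_range n).bddAbove
  refine ⟨N, fun r hr => (Subgroup.eq_bot_iff_forall _).mpr fun σ hσ => hn σ ?_⟩
  exact lowerRamificationGroup_antitone F K
    ((Nat.cast_le.mpr (hN (Set.mem_range_self σ))).trans hr) hσ

variable {K} in
/-- The group `G_r` is a `p`-group for `r > 0`. -/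
theorem exists_pow_prime_pow_eq_one [Algebra.IsSeparable F K] (p : ℕ) [CharP 𝓀[F] p] {r : ℝ}
    (hr : 0 < r) {σ : Gal(K/F)} (hσ : σ ∈ lowerRamificationGroup F K r) :
    ∃ k : ℕ, σ ^ p ^ k = 1 := by
  have := isNoetherianRing_integers F K
  have h0 : orderOf σ ≠ 0 := (orderOf_pos σ).ne'
  have hunique {l : ℕ} (hl : l.Prime) (hdvd : l ∣ orderOf σ) : l = p := by
    by_contra hne
    obtain ⟨m, hm⟩ := hdvd
    have hm0 : m ≠ 0 := fun h => h0 (by rw [hm, h, mul_zero])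
    -- `σ ^ m` has order `l`, so it is trivial as soon as `l` is invertible in `𝒪_K`.
    have hpl : ¬ p ∣ l := fun h => ((Nat.dvd_prime hl).mp h).elim
      (fun h1 => CharP.char_ne_one 𝓀[F] p h1) fun h1 => hne h1.symm
    have hone : σ ^ m = 1 := by
      refine eq_one_of_forall_smul_eq F (smul_eq_self_of_pow_eq_one (fun x => ?_)
        (isUnit_natCast_integers F K p hpl) ?_)
      · exact smul_sub_mem_of_mem_lowerRamificationGroup F (by push_cast; linarith)
          (pow_mem hσ m) x
      · rw [← pow_mul, mul_comm, ← hm, pow_orderOf_eq_one]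
    have := Nat.le_of_dvd (Nat.pos_of_ne_zero hm0) (orderOf_dvd_of_pow_eq_one hone)
    rw [hm] at this
    exact hl.one_lt.not_ge (Nat.le_of_mul_le_mul_right (by simpa using this) (by omega))
  refine ⟨(orderOf σ).primeFactorsList.length, ?_⟩
  rw [← Nat.eq_prime_pow_of_unique_prime_dvd h0 hunique, pow_orderOf_eq_one]

/-- The slope `1 / [G_0 : G_t]` of the Herbrand function `φ` at `t`. -/
noncomputable def herbrandSlope (t : ℝ) : ℝ :=
  (((lowerRamificationGroup F K t).relIndex (lowerRamificationGroup F K 0) : ℕ) : ℝ)⁻¹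

theorem herbrandPhi_eq (r : ℝ) :
    herbrandPhi F K r = -1 + ∫ t in (-1)..r, herbrandSlope F K t :=
  rfl

theorem herbrandSlope_pos (t : ℝ) : 0 < herbrandSlope F K t :=
  inv_pos.mpr (Nat.cast_pos.mpr
    (Nat.pos_of_ne_zero (lowerRamificationGroup_relIndex_ne_zero F K _)))

theorem inv_card_le_herbrandSlope (t : ℝ) :
    ((Nat.card (lowerRamificationGroup F K 0) : ℕ) : ℝ)⁻¹ ≤ herbrandSlope F K t :=
  inv_anti₀ (Nat.cast_pos.mpr (Nat.pos_of_ne_zero (lowerRamificationGroup_relIndex_ne_zero F K _)))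
    (Nat.cast_le.mpr (Nat.le_of_dvd Nat.card_pos (Subgroup.relIndex_dvd_card _ _)))

theorem herbrandSlope_antitone : Antitone (herbrandSlope F K) := fun _ _ h =>
  inv_anti₀ (Nat.cast_pos.mpr (Nat.pos_of_ne_zero (lowerRamificationGroup_relIndex_ne_zero F K _)))
    (Nat.cast_le.mpr (Subgroup.relIndex_le_of_le_left
      (lowerRamificationGroup_antitone F K h) (lowerRamificationGroup_relIndex_ne_zero F K _)))

theorem herbrandSlope_intervalIntegrable (a b : ℝ) :
    IntervalIntegrable (herbrandSlope F K) MeasureTheory.volume a b :=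
  (herbrandSlope_antitone F K).intervalIntegrable

theorem herbrandPhi_strictMono : StrictMono (herbrandPhi F K) := by
  intro a b hab
  have hadd := intervalIntegral.integral_add_adjacent_intervals
    (herbrandSlope_intervalIntegrable F K (-1) a) (herbrandSlope_intervalIntegrable F K a b)
  have hpos := intervalIntegral.intervalIntegral_pos_of_pos
    (herbrandSlope_intervalIntegrable F K a b) (herbrandSlope_pos F K) hab
  rw [herbrandPhi_eq, herbrandPhi_eq]
  linarith

theorem herbrandPhi_neg_one : herbrandPhi F K (-1) = -1 := by
  rw [herbrandPhi_eq, intervalIntegral.integral_same, add_zero]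

theorem herbrandPhi_zero : herbrandPhi F K 0 = 0 := by
  have : ∫ t in (-1)..0, herbrandSlope F K t = ∫ _ in (-1 : ℝ)..0, (1 : ℝ) := by
    refine intervalIntegral.integral_congr fun t ht => ?_
    rw [Set.uIcc_of_le (by norm_num)] at ht
    rw [herbrandSlope, Subgroup.relIndex_eq_one.mpr (lowerRamificationGroup_antitone F K ht.2),
      Nat.cast_one, inv_one]
  rw [herbrandPhi_eq, this, intervalIntegral.integral_const]
  norm_num

theorem continuous_herbrandPhi : Continuous (herbrandPhi F K) :=
  continuous_const.add (intervalIntegral.continuous_primitive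
    (herbrandSlope_intervalIntegrable F K) (-1))

theorem le_herbrandPhi {r : ℝ} (hr : -1 ≤ r) :
    -1 + (r + 1) * ((Nat.card (lowerRamificationGroup F K 0) : ℕ) : ℝ)⁻¹ ≤
      herbrandPhi F K r := by
  have := intervalIntegral.integral_mono_on hr
    intervalIntegrable_const (herbrandSlope_intervalIntegrable F K (-1) r)
    fun t _ => inv_card_le_herbrandSlope F K t
  rw [intervalIntegral.integral_const, smul_eq_mul, sub_neg_eq_add] at this
  rw [herbrandPhi_eq]
  linarith

theorem exists_herbrandPhi_eq {s : ℝ} (hs : -1 ≤ s) :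
    ∃ r ∈ Set.Ici (-1 : ℝ), herbrandPhi F K r = s := by
  set c : ℝ := ((Nat.card (lowerRamificationGroup F K 0) : ℕ) : ℝ)
  have hc : 0 < c := Nat.cast_pos.mpr Nat.card_pos
  have hR : -1 ≤ (s + 1) * c - 1 := by nlinarith
  have hle := le_herbrandPhi F K hR
  rw [sub_add_cancel, mul_inv_cancel_right₀ hc.ne'] at hle
  obtain ⟨r, hr, hrs⟩ := intermediate_value_Icc hR (continuous_herbrandPhi F K).continuousOn
    ⟨(herbrandPhi_neg_one F K).trans_le hs, by linarith⟩
  exact ⟨r, hr.1, hrs⟩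

theorem herbrandPhi_herbrandPsi {s : ℝ} (hs : -1 ≤ s) :
    herbrandPhi F K (herbrandPsi F K s) = s :=
  Function.invFunOn_eq (exists_herbrandPhi_eq F K hs)

theorem le_herbrandPsi_iff {r s : ℝ} (hs : -1 ≤ s) :
    r ≤ herbrandPsi F K s ↔ herbrandPhi F K r ≤ s := by
  rw [← (herbrandPhi_strictMono F K).le_iff_le, herbrandPhi_herbrandPsi F K hs]

theorem lt_herbrandPsi_iff {r s : ℝ} (hs : -1 ≤ s) :
    r < herbrandPsi F K s ↔ herbrandPhi F K r < s := by
  rw [← (herbrandPhi_strictMono F K).lt_iff_lt, herbrandPhi_herbrandPsi F K hs]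

theorem upperRamificationGroup_le {s t : ℝ} (hs : -1 ≤ s) (hst : s ≤ t) :
    upperRamificationGroup F K t ≤ upperRamificationGroup F K s := by
  refine lowerRamificationGroup_antitone F K ((le_herbrandPsi_iff F K (hs.trans hst)).mpr ?_)
  rwa [herbrandPhi_herbrandPsi F K hs]

theorem exists_upperRamificationGroup_eq_bot [Algebra.IsSeparable F K] :
    ∃ T : ℝ, ∀ s, T ≤ s → upperRamificationGroup F K s = ⊥ := by
  obtain ⟨N, hN⟩ := exists_lowerRamificationGroup_eq_bot F K
  refine ⟨max (-1) (herbrandPhi F K N), fun s hs => hN _ ?_⟩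
  exact (le_herbrandPsi_iff F K ((le_max_left _ _).trans hs)).mpr ((le_max_right _ _).trans hs)

variable {K} in
theorem smul_sub_mem_of_mem_upperRamificationGroup {s : ℝ} (hs : 0 ≤ s) {σ : Gal(K/F)}
    (hσ : σ ∈ upperRamificationGroup F K s) (x : integers F K) :
    σ • x - x ∈ IsLocalRing.maximalIdeal (integers F K) := by
  have h0 : 0 ≤ herbrandPsi F K s :=
    (le_herbrandPsi_iff F K (by linarith)).mpr ((herbrandPhi_zero F K).trans_le hs)
  simpa using smul_sub_mem_of_mem_lowerRamificationGroup F (n := 1) (by push_cast; linarith) hσ x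

variable {K} in
theorem exists_pow_eq_one_of_mem_upperRamificationGroup [Algebra.IsSeparable F K] (p : ℕ)
    [CharP 𝓀[F] p] {s : ℝ} (hs : 0 < s) {σ : Gal(K/F)}
    (hσ : σ ∈ upperRamificationGroup F K s) : ∃ k : ℕ, σ ^ p ^ k = 1 :=
  exists_pow_prime_pow_eq_one F p
    ((lt_herbrandPsi_iff F K (by linarith)).mpr ((herbrandPhi_zero F K).trans_lt hs)) hσ

end FiniteLevel

end ArtinConductor

/-! ### Characters with values in an ultrametric field -/

namespace ArtinConductor

section Ultrametric

variable {E : Type*} [NormedField E]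

theorem isUltrametricDist_of_padic (ℓ : ℕ) [Fact ℓ.Prime] [NormedAlgebra ℚ_[ℓ] E] :
    IsUltrametricDist E :=
  IsUltrametricDist.isUltrametricDist_of_forall_norm_natCast_le_one fun n => by
    rw [← map_natCast (algebraMap ℚ_[ℓ] E), norm_algebraMap']
    exact IsUltrametricDist.norm_natCast_le_one _ n

theorem norm_natCast_eq_one_of_coprime {ℓ : ℕ} [Fact ℓ.Prime] [NormedAlgebra ℚ_[ℓ] E] {m : ℕ}
    (h : ℓ.Coprime m) : ‖(m : E)‖ = 1 := by
  rw [← map_natCast (algebraMap ℚ_[ℓ] E), norm_algebraMap', Padic.norm_natCast_eq_one_iff]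
  exact h

variable [IsUltrametricDist E]

theorem norm_pow_sub_one_le {x : E} (hx : ‖x - 1‖ ≤ 1) (i : ℕ) : ‖x ^ i - 1‖ ≤ ‖x - 1‖ := by
  have hx1 : ‖x‖ ≤ 1 := by
    simpa using (IsUltrametricDist.norm_add_le_max (x - 1) 1).trans (max_le hx norm_one.le)
  have hsum : ‖∑ j ∈ Finset.range i, x ^ j‖ ≤ 1 :=
    IsUltrametricDist.norm_sum_le_of_forall_le_of_nonneg zero_le_one fun j _ => by
      rw [norm_pow]
      exact pow_le_one₀ (norm_nonneg x) hx1
  rw [← geom_sum_mul, norm_mul]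
  exact mul_le_of_le_one_left (norm_nonneg _) hsum

/-- On the open unit ball around `1`, raising to a power prime to the residue characteristic
preserves the distance to `1`. -/
theorem norm_pow_sub_one_eq {x : E} (hx : ‖x - 1‖ < 1) {m : ℕ} (hm : ‖(m : E)‖ = 1) :
    ‖x ^ m - 1‖ = ‖x - 1‖ := by
  have hlt : ‖∑ j ∈ Finset.range m, (x ^ j - 1)‖ < ‖(m : E)‖ := by
    rw [hm]
    exact (IsUltrametricDist.norm_sum_le_of_forall_le_of_nonneg (norm_nonneg _)
      fun j _ => norm_pow_sub_one_le hx.le j).trans_lt hx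
  have hsum : ∑ j ∈ Finset.range m, x ^ j = ∑ j ∈ Finset.range m, (x ^ j - 1) + m := by
    simp
  rw [← geom_sum_mul, norm_mul, hsum,
    IsUltrametricDist.norm_add_eq_max_of_norm_ne_norm hlt.ne, max_eq_right hlt.le, hm, one_mul]

end Ultrametric

/-! ### Ramification subgroups of the Weil group -/

section Weil

variable {F : Type*} [Field F] [ValuativeRel F] [TopologicalSpace F]
  [IsNonarchimedeanLocalField F]
variable {Fbar : Type*} [Field Fbar] [Algebra F Fbar]

theorem restrictNormalHom_mem_upperRamificationGroup {s : ℝ} {σ : Gal(Fbar/F)}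
    (hσ : σ ∈ absoluteRamificationGroup F Fbar s) (K : FiniteGaloisIntermediateField F Fbar) :
    AlgEquiv.restrictNormalHom K σ ∈ upperRamificationGroup F K s :=
  Subgroup.mem_iInf.mp hσ K

theorem ramification_le [Algebra.IsAlgebraic F Fbar] {s t : ℝ} (hs : -1 ≤ s) (hst : s ≤ t) :
    WeilGroup.ramification F Fbar t ≤ WeilGroup.ramification F Fbar s :=
  Subgroup.comap_mono (iInf_mono fun K =>
    Subgroup.comap_mono (upperRamificationGroup_le F K hs hst))

variable [IsGalois F Fbar]

theorem ramification_le_inertia {s : ℝ} (hs : 0 ≤ s) :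
    WeilGroup.ramification F Fbar s ≤ WeilGroup.inertia F Fbar := by
  intro w hw z
  obtain ⟨x, rfl⟩ := IsLocalRing.residue_surjective z
  set σ := WeilGroup.toGal F Fbar w
  change σ • IsLocalRing.residue _ x = _
  rw [← IsLocalRing.ResidueField.residue_smul, ← sub_eq_zero, ← map_sub,
    IsLocalRing.residue_eq_zero_iff, IsLocalRing.mem_maximalIdeal, mem_nonunits_iff]
  intro hunit
  let K := FiniteGaloisIntermediateField.adjoin F {(x : Fbar)}
  have hxK : (x : Fbar) ∈ K.toIntermediateField :=
    FiniteGaloisIntermediateField.subset_adjoin F {(x : Fbar)} rfl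
  have hint (a : K) (ha : IsIntegral 𝒪[F] (a : Fbar)) : IsIntegral 𝒪[F] a :=
    (isIntegral_algHom_iff (K.toIntermediateField.val.restrictScalars 𝒪[F])
      Subtype.val_injective).mp ha
  let y : integers F K := ⟨⟨x, hxK⟩, hint _ x.2⟩
  let τ : Gal(K/F) := AlgEquiv.restrictNormalHom K σ
  have hmem := smul_sub_mem_of_mem_upperRamificationGroup F hs
    (restrictNormalHom_mem_upperRamificationGroup hw K) y
  have hd : (((τ • y - y : integers F K) : K) : Fbar) = ((σ • x - x : integers F Fbar) : Fbar) :=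
    congrArg (· - (x : Fbar)) (AlgEquiv.restrictNormalHom_apply K.toIntermediateField σ ⟨x, hxK⟩)
  -- The inverse of `σ x - x` is integral and lies in `K`.
  obtain ⟨u, hu⟩ := hunit.exists_right_inv
  have hu' : ((σ • x - x : integers F Fbar) : Fbar) * u = 1 := congrArg Subtype.val hu
  have hinv : IsIntegral 𝒪[F] (((τ • y - y : integers F K) : K)⁻¹) := by
    refine hint _ ?_
    have : ((((τ • y - y : integers F K) : K)⁻¹ : K) : Fbar) = u := by
      rw [IntermediateField.coe_inv, hd]
      exact inv_eq_of_mul_eq_one_right hu'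
    rw [this]
    exact u.2
  have hne : ((τ • y - y : integers F K) : K) ≠ 0 := by
    intro h0
    rw [← hd, h0, ZeroMemClass.coe_zero, zero_mul] at hu'
    exact zero_ne_one hu'
  exact hmem (IsUnit.of_mul_eq_one (⟨_, hinv⟩ : integers F K) (Subtype.ext (mul_inv_cancel₀ hne)))

/-- The subgroups `Gal(Fbar/K) ∩ I_F` form a basis of neighbourhoods of `1` in `W_F`. -/
theorem exists_restrictNormalHom_eq_one_imp {U : Set (WeilGroup F Fbar)} (hU : U ∈ nhds 1) :
    ∃ K : FiniteGaloisIntermediateField F Fbar, ∀ w ∈ WeilGroup.inertia F Fbar,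
      AlgEquiv.restrictNormalHom K (WeilGroup.toGal F Fbar w) = 1 → w ∈ U := by
  have hnhds : nhds (1 : WeilGroup F Fbar) =
      Filter.comap (WeilGroup.toGal F Fbar) (nhds 1) ⊓
        Filter.comap (QuotientGroup.mk : _ → WeilGroup F Fbar ⧸ WeilGroup.inertia F Fbar)
          (pure (QuotientGroup.mk 1)) := by
    refine (nhds_inf (t₁ := TopologicalSpace.induced (WeilGroup.toGal F Fbar) inferInstance)
      (t₂ := TopologicalSpace.induced (QuotientGroup.mk :
        _ → WeilGroup F Fbar ⧸ WeilGroup.inertia F Fbar) ⊥)).trans ?_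
    rw [nhds_induced, map_one]
    exact congrArg _ ((@nhds_induced _ _ ⊥ _ _).trans
      (congrArg _ (congrFun (@nhds_discrete _ ⊥ (@DiscreteTopology.mk _ ⊥ rfl)) _)))
  rw [hnhds, Filter.mem_inf_iff] at hU
  obtain ⟨A, ⟨A', hA', hA⟩, B, ⟨B', hB', hB⟩, rfl⟩ := hU
  obtain ⟨L, hfin, hnormal, hL⟩ := (krullTopology_mem_nhds_one_iff_of_normal F Fbar A').mp hA'
  have : IsGalois F L := ⟨⟩
  refine ⟨{ toIntermediateField := L, finiteDimensional := hfin, isGalois := this },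
    fun w hw hwL => ⟨hA (hL ?_), hB ?_⟩⟩
  · intro x
    have := AlgEquiv.restrictNormalHom_apply L (WeilGroup.toGal F Fbar w) x
    refine this.symm.trans ?_
    exact congrArg (fun τ : Gal(L/F) => ((τ x : L) : Fbar)) hwL
  · change QuotientGroup.mk w ∈ B'
    rw [(WeilGroup.quotient_mk_eq_one_iff F Fbar w).mpr hw]
    exact hB'

/-- An `ℓ`-adic character is trivial on `G_F^s` for large `s`: for large `s` it maps `G_F^s` into
the open unit ball around `1`, and the restrictions of `G_F^s` to finite extensions are `p`-groups. -/
theorem exists_forall_ramification_eq_one (p : ℕ) [CharP 𝓀[F] p] (ℓ : ℕ) [Fact ℓ.Prime]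
    (hℓ : ℓ ≠ p) {E : Type*} [NormedField E] [NormedAlgebra ℚ_[ℓ] E]
    {χ : WeilGroup F Fbar →* Eˣ} (hχ : Continuous χ) :
    ∃ T : ℝ, ∀ s, T ≤ s → ∀ w ∈ WeilGroup.ramification F Fbar s, χ w = 1 := by
  have := isUltrametricDist_of_padic (E := E) ℓ
  have hp : p.Prime := CharP.char_is_prime 𝓀[F] p
  have hnorm (k : ℕ) : ‖((p ^ k : ℕ) : E)‖ = 1 := norm_natCast_eq_one_of_coprime
    (((Nat.coprime_primes Fact.out hp).mpr hℓ).pow_right k)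
  have hball {ε : ℝ} (hε : 0 < ε) :
      ∃ K : FiniteGaloisIntermediateField F Fbar, ∀ w ∈ WeilGroup.inertia F Fbar,
        AlgEquiv.restrictNormalHom K (WeilGroup.toGal F Fbar w) = 1 → ‖(χ w : E) - 1‖ < ε := by
    refine exists_restrictNormalHom_eq_one_imp
      (U := {w | ‖(χ w : E) - 1‖ < ε}) (IsOpen.mem_nhds ?_ (by simpa using hε))
    exact isOpen_lt (((Units.continuous_val.comp hχ).sub continuous_const).norm) continuous_const
  obtain ⟨K, hK⟩ := hball one_pos
  obtain ⟨T, hT⟩ := exists_upperRamificationGroup_eq_bot F K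
  refine ⟨max 1 T, fun s hs w hw => ?_⟩
  have hs0 : 0 < s := one_pos.trans_le ((le_max_left _ _).trans hs)
  have hwI := ramification_le_inertia hs0.le hw
  have hw1 : ‖(χ w : E) - 1‖ < 1 := by
    refine hK w hwI (Subgroup.mem_bot.mp ?_)
    rw [← hT s ((le_max_right _ _).trans hs)]
    exact restrictNormalHom_mem_upperRamificationGroup hw K
  by_contra hne
  -- The powers `w ^ p ^ k` come arbitrarily close to `1`, while `χ (w ^ p ^ k)` stays at the same
  -- distance from `1` as `χ w`.
  have hpos : 0 < ‖(χ w : E) - 1‖ :=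
    norm_pos_iff.mpr (sub_ne_zero.mpr fun h => hne (Units.ext h))
  obtain ⟨L, hL⟩ := hball hpos
  obtain ⟨k, hk⟩ := exists_pow_eq_one_of_mem_upperRamificationGroup F p hs0
    (restrictNormalHom_mem_upperRamificationGroup hw L)
  have := hL (w ^ p ^ k) (pow_mem hwI _) (by rw [map_pow, map_pow, hk])
  rw [map_pow, Units.val_pow_eq_pow_val, norm_pow_sub_one_eq hw1 (hnorm k)] at this
  exact lt_irrefl _ this

/-! ### Conductors -/

theorem wildConductor_ne_top {E V : Type*} [Field E] [AddCommGroup V] [Module E V]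
    [FiniteDimensional E V] (ρ : Representation E (WeilGroup F Fbar) V) {T : ℝ}
    (h : ∀ s, T ≤ s → ∀ w ∈ WeilGroup.ramification F Fbar s, ρ w = 1) :
    wildConductor ρ ≠ ⊤ := by
  have hle (s : ℝ) : (codimInvariants ρ (WeilGroup.ramification F Fbar s) : ℝ≥0∞) ≤
      (Set.Iio T).indicator (fun _ => (Module.finrank E V : ℝ≥0∞)) s := by
    by_cases hs : s < T
    · rw [Set.indicator_of_mem (Set.mem_Iio.mpr hs)]
      exact Nat.cast_le.mpr (Submodule.finrank_quotient_le _)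
    · rw [codimInvariants_eq_zero ρ (h s (not_lt.mp hs)), Nat.cast_zero]
      exact zero_le
  refine ne_top_of_le_ne_top ?_ (MeasureTheory.lintegral_mono hle)
  rw [MeasureTheory.lintegral_indicator_const measurableSet_Iio,
    MeasureTheory.Measure.restrict_apply measurableSet_Iio, Set.Iio_inter_Ioi, Real.volume_Ioo]
  exact ENNReal.mul_ne_top (ENNReal.natCast_ne_top _) ENNReal.ofReal_ne_top

theorem conductor_ofCharacter_ne_top {E : Type*} [Field E] {χ : WeilGroup F Fbar →* Eˣ} {T : ℝ}
    (h : ∀ s, T ≤ s → ∀ w ∈ WeilGroup.ramification F Fbar s, χ w = 1) :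
    conductor (ofCharacter χ) ≠ ⊤ := by
  have : FiniteDimensional E (SemisimplificationSpace (ofCharacter χ)) :=
    Module.finite_of_finrank_pos (by
      rw [finrank_semisimplificationSpace, Module.finrank_self]
      exact one_pos)
  refine ENNReal.add_ne_top.mpr ⟨ENNReal.natCast_ne_top _, wildConductor_ne_top _ (T := T)
    fun s hs w hw => ?_⟩
  rw [semisimplification_eq_smul _ (ofCharacter_eq_smul χ w), h s hs w hw, Units.val_one, one_smul]

/-- If `G_F^s` acts on `V` through a character `χ` that is nontrivial on it, then the conductor of
`V` is `dim V` times that of `χ`. -/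
theorem conductor_eq_finrank_mul {E V : Type*} [Field E] [AddCommGroup V] [Module E V]
    [FiniteDimensional E V] (ρ : Representation E (WeilGroup F Fbar) V)
    (χ : WeilGroup F Fbar →* Eˣ) {s : ℝ} (hs : 0 ≤ s)
    (hρ : ∀ w ∈ WeilGroup.ramification F Fbar s, ρ w = (χ w : E) • 1)
    (hχ : ∃ w ∈ WeilGroup.ramification F Fbar s, χ w ≠ 1) :
    conductor ρ = Module.finrank E V * conductor (ofCharacter χ) := by
  have htame : tameConductor ρ = Module.finrank E V * tameConductor (ofCharacter χ) :=
    codimInvariants_eq_mul ρ χ hρ hχ (Or.inr (ramification_le_inertia hs))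
  have hwild : wildConductor (semisimplification ρ) =
      Module.finrank E V * wildConductor (semisimplification (ofCharacter χ)) := by
    rw [wildConductor, wildConductor,
      ← MeasureTheory.lintegral_const_mul' _ _ (ENNReal.natCast_ne_top _)]
    refine MeasureTheory.setLIntegral_congr_fun measurableSet_Ioi fun t ht => ?_
    have ht0 : (0 : ℝ) < t := ht
    have hcomp := (le_total s t).imp
      (ramification_le (F := F) (Fbar := Fbar) (by linarith : (-1 : ℝ) ≤ s))
      (ramification_le (F := F) (Fbar := Fbar) (by linarith : (-1 : ℝ) ≤ t))
    change ((codimInvariants _ _ : ℕ) : ℝ≥0∞) = _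
    rw [codimInvariants_semisimplification_eq_mul ρ χ hρ hχ hcomp, Nat.cast_mul]
  rw [conductor, conductor, htame, hwild, Nat.cast_mul, mul_add]

end Weil

end ArtinConductor

theorem mainTheorem2
    (F : Type*) [Field F] [ValuativeRel F] [TopologicalSpace F] [IsNonarchimedeanLocalField F]
    (p : ℕ) [CharP 𝓀[F] p]
    (Fbar : Type*) [Field Fbar] [Algebra F Fbar] [IsSepClosure F Fbar]
    (ℓ : ℕ) [Fact ℓ.Prime] (hℓ : ℓ ≠ p)
    (E : Type*) [NormedField E] [NormedAlgebra ℚ_[ℓ] E] [FiniteDimensional ℚ_[ℓ] E]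
    (n : ℕ) (ρ : ArtinConductor.WeilGroup F Fbar →* GL (Fin n) E) (hρ : Continuous ρ)
    (χ : ArtinConductor.WeilGroup F Fbar →* Eˣ) (hχ : Continuous χ)
    (h : ArtinConductor.IsMoreDeeplyRamified χ ρ) :
    ArtinConductor.conductor (ArtinConductor.ofCharacter χ) ≠ ⊤ ∧
    ArtinConductor.conductor
        ((ArtinConductor.ofGL ρ).tprod (ArtinConductor.ofCharacter χ)) =
      n * ArtinConductor.conductor (ArtinConductor.ofCharacter χ) := by
  have : IsGalois F Fbar := IsSepClosure.isGalois
  obtain ⟨T, hT⟩ := ArtinConductor.exists_forall_ramification_eq_one p ℓ hℓ hχ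
  obtain ⟨s, hs, hρs, hχs⟩ := h
  refine ⟨ArtinConductor.conductor_ofCharacter_ne_top hT, ?_⟩
  rw [ArtinConductor.conductor_eq_finrank_mul _ χ hs (fun w hw =>
    ArtinConductor.ofGL_tprod_ofCharacter_eq_smul ρ χ (hρs w hw)) hχs]
  simp
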